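/- Consider the triangular lattice in the plane (unit equilateral triangles as faces). A polyiamond is a nonempty finite set of faces that is connected through shared edges; its area is its number of faces, and its site-perimeter $s(P)$ is the number of faces not in $P$ that share at least one edge with a face of $P$. A bar $B(l)$ is the set of $2l-1$ faces obtained from an equilateral lattice triangle of side length $l$ by removing an equilateral triangle of side length $l-1$ sharing a corner with it; its larger base is the side, of length $l$, opposite to that corner. For $r\ge 1$ let $E_{B_0}(r)=E(r)$ be the regular lattice hexagon of side length $r$. For $i=1,\dots,6$, $E_{B_i}(r)$ is obtained from $E_{B_{i-1}}(r)$ by attaching to one of its sides, along its larger base, a bar $B(l_i)$, where $l_1=r$, $l_2=\dots=l_5=r+1$, $l_6=r+2$, in such a way that the result is contained in a regular hexagon $E(r+1)$. The polyiamonds $E_{B_i}(r)$ with $r\ge1$, $0\le i\le 6$ are called quasi-regular hexagons. **Proposition.** Quasi-regular hexagons are the unique polyiamonds of maximal area for fixed site-perimeter. That is, for every integer $s\ge 6$, a polyiamond $P$ has site-perimeter $s$ and has maximal area among all polyiamonds of site-perimeter $s$ if and only if $P$ is a quasi-regular hexagon with $s(P)=s$. More precisely, if $s=6r+i$ with $r\ge1$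 and $0\le i\le5$, then the polyiamonds of maximal area among those of site-perimeter $s$ are exactly the polyiamonds $E_{B_i}(r)$; these exist, and they form a single class up to translations of the lattice and rotations by multiples of $\pi/3$. -/

import Mathlib

namespace TriLattice

/-- A face of the triangular lattice. The lattice vertex with coordinates `(x, y) : ℤ × ℤ` is the
point `x • (1, 0) + y • (1/2, √3/2)` of the plane. The face `(x, y, true)` is the upward unit triangle
with lower left corner `(x, y)`, and `(x, y, false)` is the downward unit triangle which shares with
it the edge from `(x + 1, y)` to `(x, y + 1)`. -/
abbrev Face := ℤ × ℤ × Bool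

/-- The three corners of a face. -/
def vertices : Face → Finset (ℤ × ℤ)
  | (x, y, true) => {(x, y), (x + 1, y), (x, y + 1)}
  | (x, y, false) => {(x + 1, y), (x, y + 1), (x + 1, y + 1)}

/-- Two faces are adjacent when they share an edge, i.e. exactly two corners. -/
def faceGraph : SimpleGraph Face where
  Adj f g := (vertices f ∩ vertices g).card = 2
  symm := ⟨fun f g h => by rwa [Finset.inter_comm]⟩
  loopless := ⟨by
    rintro ⟨x, y, _ | _⟩ h <;> simp [vertices] at h⟩

/-- A polyiamond: a (nonempty) finite edge-connected set of faces. Its area is `P.card`. -/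
def IsPolyiamond (P : Finset Face) : Prop :=
  (faceGraph.induce (P : Set Face)).Connected

/-- The site-perimeter: the number of faces outside `P` sharing at least one edge with `P`. -/
noncomputable def sitePerimeter (P : Finset Face) : ℕ :=
  {f : Face | f ∉ P ∧ ∃ g ∈ P, faceGraph.Adj f g}.ncard

/-- `P` has the largest area among all polyiamonds of site-perimeter `s`. -/
def IsAreaMaximizer (s : ℕ) (P : Finset Face) : Prop :=
  IsPolyiamond P ∧ sitePerimeter P = s ∧
    ∀ Q : Finset Face, IsPolyiamond Q → sitePerimeter Q = s → Q.card ≤ P.card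

/-- Translation of a face by the lattice vector `t`. -/
def translate (t : ℤ × ℤ) (f : Face) : Face := (f.1 + t.1, f.2.1 + t.2, f.2.2)

/-- Counter-clockwise rotation of faces by `π / 3` about the vertex `(0, 0)`
(on vertices it is `(x, y) ↦ (-y, x + y)`, see `vertices_rotate`). -/
def rotate : Face → Face
  | (x, y, true) => (-y - 1, x + y, false)
  | (x, y, false) => (-y - 1, x + y + 1, true)

/-- Rotation by `k * π / 3` about `(0, 0)` followed by translation by `t`. -/
def move (k : ℕ) (t : ℤ × ℤ) (f : Face) : Face := translate t (rotate^[k] f)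

/-- `Q` is obtained from `P` by a rotation by a multiple of `π / 3` and a translation. -/
def LatticeCongruent (P Q : Finset Face) : Prop :=
  ∃ (k : ℕ) (t : ℤ × ℤ), Q = P.image (move k t)

/-- The regular hexagon `E(r)` of radius (side length) `r` centred at the vertex `(0, 0)`:
all faces contained in it. -/
noncomputable def hexagon (r : ℕ) : Finset Face :=
  (Finset.Icc (-r : ℤ) r ×ˢ Finset.Icc (-r : ℤ) r ×ˢ Finset.univ).filter fun f =>
    ∀ p ∈ vertices f, |p.1| ≤ (r : ℤ) ∧ |p.2| ≤ (r : ℤ) ∧ |p.1 + p.2| ≤ (r : ℤ)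

/-- The upward equilateral triangle of side length `l` with corners `(0, 0)`, `(l, 0)`, `(0, l)`. -/
noncomputable def triangle (l : ℕ) : Finset Face :=
  (Finset.Icc (0 : ℤ) l ×ˢ Finset.Icc (0 : ℤ) l ×ˢ Finset.univ).filter fun f =>
    ∀ p ∈ vertices f, 0 ≤ p.1 ∧ 0 ≤ p.2 ∧ p.1 + p.2 ≤ (l : ℤ)

/-- The bar `B(l)` (for `1 ≤ l`) with larger base the segment from `(0, 0)` to `(l, 0)`: the triangle
of side `l` minus the triangle of side `l - 1` that has the same top corner. -/
noncomputable def bar (l : ℕ) : Finset Face := triangle l \ (triangle (l - 1)).image (translate (0, 1))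

/-- The `l` faces on the other side of the larger base of `bar l`. -/
def underBar (l : ℕ) : Finset Face :=
  (Finset.range l).image fun j : ℕ => ((j : ℤ), (-1 : ℤ), false)

/-- `P` is obtained from `Q` by attaching outside `Q`, along its larger base, a bar `B(l)`
in any position and orientation. -/
def AttachBar (l : ℕ) (Q P : Finset Face) : Prop :=
  ∃ (k : ℕ) (t : ℤ × ℤ), (underBar l).image (move k t) ⊆ Q ∧
    Disjoint Q ((bar l).image (move k t)) ∧ P = Q ∪ (bar l).image (move k t)

/-- Length of the larger base of the bar attached to `E_{B_i}(r)` in order to obtain `E_{B_{i+1}}(r)`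
(for `i ≤ 5`): `r` for the first bar, `r + 2` for the sixth, `r + 1` otherwise. -/
def barLength (r i : ℕ) : ℕ := if i = 0 then r else if i = 5 then r + 2 else r + 1

/-- `P` is a regular hexagon of radius `r`, anywhere in the lattice. -/
def IsRegularHexagon (r : ℕ) (P : Finset Face) : Prop :=
  ∃ t : ℤ × ℤ, P = (hexagon r).image (translate t)

/-- `IsEB r i P`: `P` is an `E_{B_i}(r)`, i.e. it arises from a regular hexagon of radius `r` by
attaching successively `i` bars so that each time the result is contained in a regular hexagon of
radius `r + 1`. -/
def IsEB (r : ℕ) : ℕ → Finset Face → Prop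
  | 0, P => IsRegularHexagon r P
  | i + 1, P => (∃ Q, IsEB r i Q ∧ AttachBar (barLength r i) Q P) ∧
      ∃ H, IsRegularHexagon (r + 1) H ∧ P ⊆ H

/-- A quasi-regular hexagon. -/
def IsQuasiRegularHexagon (P : Finset Face) : Prop :=
  ∃ r i : ℕ, 1 ≤ r ∧ i ≤ 6 ∧ IsEB r i P

theorem vertices_rotate (f : Face) :
    vertices (rotate f) = (vertices f).image fun p => (-p.2, p.1 + p.2) := by
  obtain ⟨x, y, _ | _⟩ := f <;> ext ⟨a, b⟩ <;>
    simp only [vertices, rotate, Finset.image_insert, Finset.image_singleton, Finset.mem_insert,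
      Finset.mem_singleton, Prod.mk.injEq] <;> lia

theorem vertices_translate (t : ℤ × ℤ) (f : Face) :
    vertices (translate t f) = (vertices f).image fun p => p + t := by
  obtain ⟨x, y, _ | _⟩ := f <;> obtain ⟨s, t⟩ := t <;> ext ⟨a, b⟩ <;>
    simp only [vertices, translate, Finset.image_insert, Finset.image_singleton, Finset.mem_insert,
      Finset.mem_singleton, Prod.mk.injEq, Prod.mk_add_mk] <;> lia

end TriLattice

open TriLattice

namespace TriLattice

/-! Faces are arranged in rows of three directions, indexed by `f.1`, `f.2.1` and `third f`. In each
row that meets `P`, the first free face past either end of the occupied part is a site. A site can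
be such a row end in at most two of its three directions, since among three truth values at most two
of the three pairs differ. Double counting shows that the number of occupied rows is at most the
site-perimeter (`card_rows_le_sitePerimeter`).

By connectedness the occupied rows of each direction form an interval, so `P` lies in a hexagonal
`box` whose three widths have sum `S ≤ s(P)`. The area of a box with nonnegative sides satisfies `S
^ 2 = 6 * area + deficit`, where `deficit` is a positive definite quadratic form in the differences
`d`, `e` of the widths and in the offset `D` (`sq_eq_card_add_deficit`). Since `S - d + e` is
divisible by 3 and `S - D` by 2, the deficit is at least a value depending only on `S` modulo 6
(`minDeficit_le_deficit`). This yields the sharp bound, and equality forces `P` to be a box of least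
deficit (`IsPolyiamond.area_le`).

Least-deficit boxes are the `E_{B_i}(r)`: a bar of the prescribed length fits only along a full side
of a least-deficit box and leads to the next residue, and conversely some side always carries a
removable bar (`isEB_iff_isExtremal`). The parameters `(d, e, D)` determine a box of given `S` up to
translation, and for each residue the optimal triples form one orbit under rotation, whence
uniqueness. All parameters involved lie in `{-1, 0, 1}`, so these claims are finite checks. -/

/-! ### Row coordinates and adjacency of faces. -/

/-- The third row coordinate of a face, along with `f.1` and `f.2.1`. -/
def third : Face → ℤ
  | (x, y, true) => x + y
  | (x, y, false) => x + y + 1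

/-- The neighbour of a face that lies in a different row of the first kind. -/
def flipX : Face → Face
  | (x, y, true) => (x - 1, y, false)
  | (x, y, false) => (x + 1, y, true)

/-- The neighbour of a face that lies in a different row of the second kind. -/
def flipY : Face → Face
  | (x, y, true) => (x, y - 1, false)
  | (x, y, false) => (x, y + 1, true)

/-- The neighbour of a face that lies in a different row of the third kind. -/
def flipZ : Face → Face
  | (x, y, true) => (x, y, false)
  | (x, y, false) => (x, y, true)

theorem third_mem (f : Face) : third f = f.1 + f.2.1 ∨ third f = f.1 + f.2.1 + 1 := by
  obtain ⟨x, y, _ | _⟩ := f <;> simp [third]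

theorem face_ext {f g : Face} (h1 : f.1 = g.1) (h2 : f.2.1 = g.2.1) (h3 : third f = third g) :
    f = g := by
  obtain ⟨x, y, _ | _⟩ := f <;> obtain ⟨x', y', _ | _⟩ := g <;> simp [third] at * <;> lia

theorem flipX_flipX (f : Face) : flipX (flipX f) = f := by
  obtain ⟨x, y, _ | _⟩ := f <;> simp [flipX]

theorem flipY_flipY (f : Face) : flipY (flipY f) = f := by
  obtain ⟨x, y, _ | _⟩ := f <;> simp [flipY]

theorem flipZ_flipZ (f : Face) : flipZ (flipZ f) = f := by
  obtain ⟨x, y, _ | _⟩ := f <;> simp [flipZ]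

theorem adj_up_down (x y x' y' : ℤ) : faceGraph.Adj (x, y, true) (x', y', false) ↔
    (x' = x - 1 ∧ y' = y) ∨ (x' = x ∧ y' = y - 1) ∨ (x' = x ∧ y' = y) := by
  change (vertices _ ∩ vertices _).card = 2 ↔ _
  constructor
  · intro h
    obtain ⟨⟨a, b⟩, ⟨c, d⟩, hne, h⟩ := Finset.card_eq_two.1 h
    have h1 : (a, b) ∈ vertices (x, y, true) ∩ vertices (x', y', false) := by simp [h]
    have h2 : (c, d) ∈ vertices (x, y, true) ∩ vertices (x', y', false) := by simp [h]
    simp only [vertices, Finset.mem_inter, Finset.mem_insert, Finset.mem_singleton,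
      Prod.mk.injEq] at h1 h2
    have : ¬ (a = c ∧ b = d) := fun h => hne (by rw [h.1, h.2])
    lia
  · rw [Finset.card_eq_two]
    rintro (⟨rfl, rfl⟩ | ⟨rfl, rfl⟩ | ⟨rfl, rfl⟩)
    · refine ⟨(x, y'), (x, y' + 1), by simp, ?_⟩
      ext ⟨a, b⟩
      simp only [vertices, Finset.mem_inter, Finset.mem_insert, Finset.mem_singleton,
        Prod.mk.injEq]
      lia
    · refine ⟨(x', y), (x' + 1, y), by simp, ?_⟩
      ext ⟨a, b⟩
      simp only [vertices, Finset.mem_inter, Finset.mem_insert, Finset.mem_singleton,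
        Prod.mk.injEq]
      lia
    · refine ⟨(x' + 1, y'), (x', y' + 1), by simp, ?_⟩
      ext ⟨a, b⟩
      simp only [vertices, Finset.mem_inter, Finset.mem_insert, Finset.mem_singleton,
        Prod.mk.injEq]
      lia

theorem not_adj_same (x y x' y' : ℤ) (b : Bool) : ¬ faceGraph.Adj (x, y, b) (x', y', b) := by
  change ¬ (vertices _ ∩ vertices _).card = 2
  intro h
  obtain ⟨⟨p, q⟩, ⟨c, d⟩, hne, h⟩ := Finset.card_eq_two.1 h
  have h1 : (p, q) ∈ vertices (x, y, b) ∩ vertices (x', y', b) := by simp [h]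
  have h2 : (c, d) ∈ vertices (x, y, b) ∩ vertices (x', y', b) := by simp [h]
  have h3 : ∀ u v, (u, v) ∈ vertices (x, y, b) ∩ vertices (x', y', b) →
      (u = p ∧ v = q) ∨ (u = c ∧ v = d) := by
    intro u v huv
    rw [h] at huv
    simpa using huv
  have hne' : ¬ (p = c ∧ q = d) := fun h => hne (by rw [h.1, h.2])
  have hx : ¬ (x = x' ∧ y = y') := by
    rintro ⟨rfl, rfl⟩
    cases b
    · have e1 := h3 (x + 1) y (by simp [vertices])
      have e2 := h3 x (y + 1) (by simp [vertices])
      have e3 := h3 (x + 1) (y + 1) (by simp [vertices])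
      lia
    · have e1 := h3 x y (by simp [vertices])
      have e2 := h3 (x + 1) y (by simp [vertices])
      have e3 := h3 x (y + 1) (by simp [vertices])
      lia
  cases b <;> simp only [vertices, Finset.mem_inter, Finset.mem_insert, Finset.mem_singleton,
      Prod.mk.injEq] at h1 h2 <;> lia

theorem adj_iff (f g : Face) :
    faceGraph.Adj f g ↔ g = flipX f ∨ g = flipY f ∨ g = flipZ f := by
  obtain ⟨x, y, _ | _⟩ := f <;> obtain ⟨x', y', _ | _⟩ := g
  · simp [not_adj_same, flipX, flipY, flipZ]
  · rw [SimpleGraph.adj_comm, adj_up_down]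
    simp only [flipX, flipY, flipZ, Prod.mk.injEq, and_true]
    lia
  · rw [adj_up_down]
    simp only [flipX, flipY, flipZ, Prod.mk.injEq, and_true]
  · simp [not_adj_same, flipX, flipY, flipZ]

/-! ### Hexagonal regions and their behaviour under lattice motions. -/

/-- The hexagonal region of all faces with the three row coordinates in given intervals. -/
noncomputable def box (x₀ x₁ y₀ y₁ z₀ z₁ : ℤ) : Finset Face :=
  (Finset.Ico x₀ x₁ ×ˢ Finset.Ico y₀ y₁ ×ˢ Finset.univ).filter fun f =>
    z₀ ≤ third f ∧ third f < z₁

theorem mem_box {x₀ x₁ y₀ y₁ z₀ z₁ : ℤ} {f : Face} : f ∈ box x₀ x₁ y₀ y₁ z₀ z₁ ↔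
    (x₀ ≤ f.1 ∧ f.1 < x₁) ∧ (y₀ ≤ f.2.1 ∧ f.2.1 < y₁) ∧ z₀ ≤ third f ∧ third f < z₁ := by
  simp [box, and_assoc]

theorem rotate_fst (f : Face) : (rotate f).1 = -f.2.1 - 1 := by
  obtain ⟨x, y, _ | _⟩ := f <;> rfl

theorem rotate_snd (f : Face) : (rotate f).2.1 = third f := by
  obtain ⟨x, y, _ | _⟩ := f <;> rfl

theorem third_rotate (f : Face) : third (rotate f) = f.1 := by
  obtain ⟨x, y, _ | _⟩ := f <;> simp only [rotate, third] <;> ring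

theorem third_translate (t : ℤ × ℤ) (f : Face) :
    third (translate t f) = third f + t.1 + t.2 := by
  obtain ⟨x, y, _ | _⟩ := f <;> simp only [translate, third] <;> ring

theorem rotate_six (f : Face) : rotate^[6] f = f := by
  apply face_ext <;> simp only [Function.iterate_succ, Function.iterate_zero, Function.comp,
    id, rotate_fst, rotate_snd, third_rotate] <;> ring

theorem translate_zero : translate 0 = id := by
  funext f; simp [translate]

theorem translate_translate (s t : ℤ × ℤ) (f : Face) :
    translate s (translate t f) = translate (t + s) f := by
  simp [translate, add_assoc]

theorem rotate_translate (t : ℤ × ℤ) (f : Face) :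
    rotate (translate t f) = translate (-t.2, t.1 + t.2) (rotate f) := by
  apply face_ext <;> simp only [third_translate, third_rotate, rotate_fst, rotate_snd] <;>
    simp only [translate, rotate_fst, rotate_snd] <;> ring

theorem translate_injective (t : ℤ × ℤ) : Function.Injective (translate t) := by
  intro f g h
  have := congrArg (translate (-t)) h
  simpa [translate_translate, translate_zero] using this

theorem rotate_injective : Function.Injective rotate := by
  intro f g h
  rw [← rotate_six f, ← rotate_six g, Function.iterate_succ_apply, h,
    ← Function.iterate_succ_apply]

theorem move_injective (k : ℕ) (t : ℤ × ℤ) : Function.Injective (move k t) :=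
  (translate_injective t).comp (rotate_injective.iterate k)

theorem box_translate (x₀ x₁ y₀ y₁ z₀ z₁ : ℤ) (t : ℤ × ℤ) :
    (box x₀ x₁ y₀ y₁ z₀ z₁).image (translate t) =
      box (x₀ + t.1) (x₁ + t.1) (y₀ + t.2) (y₁ + t.2) (z₀ + t.1 + t.2) (z₁ + t.1 + t.2) := by
  ext g
  rw [Finset.mem_image]
  constructor
  · rintro ⟨f, hf, rfl⟩
    rw [mem_box] at hf ⊢
    rw [third_translate]
    simp only [translate]
    lia
  · intro hg
    refine ⟨translate (-t) g, ?_, by simp [translate_translate, translate_zero]⟩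
    rw [mem_box] at hg ⊢
    rw [third_translate]
    simp only [translate, Prod.fst_neg, Prod.snd_neg]
    lia

/-- Rotation acts on row coordinates by `(x, y, z) ↦ (-y - 1, z, x)`; the shift by 1 turns the
reflected half-open interval into a half-open interval again. -/
theorem box_rotate (x₀ x₁ y₀ y₁ z₀ z₁ : ℤ) :
    (box x₀ x₁ y₀ y₁ z₀ z₁).image rotate = box (-y₁) (-y₀) z₀ z₁ x₀ x₁ := by
  ext g
  rw [Finset.mem_image]
  constructor
  · rintro ⟨f, hf, rfl⟩
    rw [mem_box] at hf ⊢
    rw [third_rotate, rotate_fst, rotate_snd]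
    lia
  · intro hg
    refine ⟨rotate^[5] g, ?_, by rw [← Function.iterate_succ_apply' rotate, rotate_six]⟩
    rw [mem_box] at hg ⊢
    simp only [Function.iterate_succ, Function.iterate_zero, Function.comp, id, rotate_fst,
      rotate_snd, third_rotate]
    lia

theorem forall_mem_vertices_up (x y : ℤ) (C : ℤ × ℤ → Prop) :
    (∀ p ∈ vertices (x, y, true), C p) ↔ C (x, y) ∧ C (x + 1, y) ∧ C (x, y + 1) := by
  simp [vertices]

theorem forall_mem_vertices_down (x y : ℤ) (C : ℤ × ℤ → Prop) :
    (∀ p ∈ vertices (x, y, false), C p) ↔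
      C (x + 1, y) ∧ C (x, y + 1) ∧ C (x + 1, y + 1) := by
  simp [vertices]

theorem hexagon_eq_box (r : ℕ) : hexagon r = box (-r) r (-r) r (-r) r := by
  ext ⟨x, y, _ | _⟩ <;> rw [mem_box, hexagon, Finset.mem_filter] <;>
    simp only [forall_mem_vertices_up, forall_mem_vertices_down, third, Finset.mem_product,
      Finset.mem_Icc, Finset.mem_univ, and_true, abs_le] <;> omega

theorem triangle_eq_box (l : ℕ) : triangle l = box 0 l 0 l 0 l := by
  ext ⟨x, y, _ | _⟩ <;> rw [mem_box, triangle, Finset.mem_filter] <;>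
    simp only [forall_mem_vertices_up, forall_mem_vertices_down, third, Finset.mem_product,
      Finset.mem_Icc, Finset.mem_univ, and_true] <;> omega

theorem bar_eq_box {l : ℕ} (hl : 1 ≤ l) : bar l = box 0 l 0 1 0 l := by
  ext f
  rw [bar, Finset.mem_sdiff, triangle_eq_box, triangle_eq_box, box_translate, mem_box, mem_box,
    mem_box]
  have := third_mem f
  push_cast [hl]
  lia

theorem mem_underBar {l : ℕ} {f : Face} :
    f ∈ underBar l ↔ 0 ≤ f.1 ∧ f.1 < l ∧ f.2.1 = -1 ∧ third f = f.1 := by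
  rw [underBar, Finset.mem_image]
  constructor
  · rintro ⟨j, hj, rfl⟩
    have := Finset.mem_range.1 hj
    simp only [third]
    lia
  · rintro ⟨h0, h1, h2, h3⟩
    refine ⟨f.1.toNat, Finset.mem_range.2 (by lia), ?_⟩
    apply face_ext
    · simp only; lia
    · simp only; lia
    · rw [h3]; simp only [third]; lia

/-! ### Connectedness of boxes, and intermediate values on polyiamonds. -/

/-- A face adjacent to `f` and one step closer to `g`, with all row coordinates between theirs. -/
theorem exists_adj_closer {f g : Face} (h : f ≠ g) :
    ∃ f', faceGraph.Adj f f' ∧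
      (min f.1 g.1 ≤ f'.1 ∧ f'.1 ≤ max f.1 g.1) ∧
      (min f.2.1 g.2.1 ≤ f'.2.1 ∧ f'.2.1 ≤ max f.2.1 g.2.1) ∧
      (min (third f) (third g) ≤ third f' ∧ third f' ≤ max (third f) (third g)) ∧
      (g.1 - f'.1).natAbs + (g.2.1 - f'.2.1).natAbs + (third g - third f').natAbs <
        (g.1 - f.1).natAbs + (g.2.1 - f.2.1).natAbs + (third g - third f).natAbs := by
  have key : ¬ (f.1 = g.1 ∧ f.2.1 = g.2.1 ∧ third f = third g) :=
    fun h' => h (face_ext h'.1 h'.2.1 h'.2.2)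
  have hg := third_mem g
  obtain ⟨gz, hgz⟩ : ∃ z, z = third g := ⟨_, rfl⟩
  rw [← hgz] at hg key ⊢
  clear hgz h
  obtain ⟨gx, gy, gb⟩ := g
  obtain ⟨x, y, _ | _⟩ := f
  · simp only [third] at key hg ⊢
    by_cases hx : x < gx
    · refine ⟨flipX (x, y, false), (adj_iff _ _).2 (by simp), ?_⟩
      simp only [flipX]
      omega
    by_cases hy : y < gy
    · refine ⟨flipY (x, y, false), (adj_iff _ _).2 (by simp), ?_⟩
      simp only [flipY]
      omega
    -- If neither `x` nor `y` has to increase, then `third g ≤ gx + gy + 1 ≤ x + y + 1`, and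
    -- equality throughout would give `f = g`; so the third coordinate has to decrease.
    · refine ⟨flipZ (x, y, false), (adj_iff _ _).2 (by simp), ?_⟩
      simp only [flipZ]
      omega
  · simp only [third] at key hg ⊢
    by_cases hx : gx < x
    · refine ⟨flipX (x, y, true), (adj_iff _ _).2 (by simp), ?_⟩
      simp only [flipX]
      omega
    by_cases hy : gy < y
    · refine ⟨flipY (x, y, true), (adj_iff _ _).2 (by simp), ?_⟩
      simp only [flipY]
      omega
    · refine ⟨flipZ (x, y, true), (adj_iff _ _).2 (by simp), ?_⟩
      simp only [flipZ]
      omega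

/-- Induction on the sum of the three coordinate distances. A box is cut out by intervals, so it
contains the face supplied by `exists_adj_closer`. -/
theorem box_reachable (x₀ x₁ y₀ y₁ z₀ z₁ : ℤ) (n : ℕ) :
    ∀ f g : (box x₀ x₁ y₀ y₁ z₀ z₁ : Set Face),
      (g.1.1 - f.1.1).natAbs + (g.1.2.1 - f.1.2.1).natAbs +
        (third g.1 - third f.1).natAbs ≤ n →
      (faceGraph.induce (box x₀ x₁ y₀ y₁ z₀ z₁ : Set Face)).Reachable f g := by
  induction n with
  | zero =>
    intro f g h
    have : f = g := Subtype.ext (face_ext (by omega) (by omega) (by omega))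
    rw [this]
  | succ n ih =>
    rintro ⟨f, hf⟩ ⟨g, hg⟩ h
    by_cases hfg : f = g
    · subst hfg; rfl
    obtain ⟨f', hadj, h1, h2, h3, h4⟩ := exists_adj_closer hfg
    have hf' : f' ∈ (box x₀ x₁ y₀ y₁ z₀ z₁ : Set Face) := by
      rw [Finset.mem_coe, mem_box] at hf hg ⊢
      omega
    have step : (faceGraph.induce (box x₀ x₁ y₀ y₁ z₀ z₁ : Set Face)).Adj ⟨f, hf⟩ ⟨f', hf'⟩ := hadj
    refine step.reachable.trans (ih ⟨f', hf'⟩ ⟨g, hg⟩ ?_)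
    simp only at h ⊢
    omega

theorem isPolyiamond_box {x₀ x₁ y₀ y₁ z₀ z₁ : ℤ} (h : (box x₀ x₁ y₀ y₁ z₀ z₁).Nonempty) :
    IsPolyiamond (box x₀ x₁ y₀ y₁ z₀ z₁) := by
  rw [IsPolyiamond, SimpleGraph.connected_iff]
  refine ⟨fun f g => box_reachable _ _ _ _ _ _ _ f g le_rfl, ?_⟩
  obtain ⟨f, hf⟩ := h
  exact ⟨⟨f, hf⟩⟩

theorem IsPolyiamond.nonempty {P : Finset Face} (hP : IsPolyiamond P) : P.Nonempty := by
  obtain ⟨f, hf⟩ := SimpleGraph.Connected.nonempty hP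
  exact ⟨f, hf⟩

/-- A coordinate that changes by at most one across an edge takes all intermediate values. -/
theorem IsPolyiamond.exists_coord_eq {P : Finset Face} (hP : IsPolyiamond P) (ρ : Face → ℤ)
    (hρ : ∀ f g, faceGraph.Adj f g → ρ g ≤ ρ f + 1) {f g : Face} (hf : f ∈ P) (hg : g ∈ P)
    {v : ℤ} (hfv : ρ f ≤ v) (hvg : v ≤ ρ g) : ∃ h ∈ P, ρ h = v := by
  by_contra! hcon
  have walk : ∀ (u w : (P : Set Face)) (_ : (faceGraph.induce (P : Set Face)).Walk u w),
      ρ u < v → ρ w < v := by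
    intro u w p
    induction p with
    | nil => exact id
    | @cons a b c hab _ ih =>
      intro ha
      have h1 : ρ b ≤ ρ a + 1 := hρ _ _ hab
      have h2 := hcon b b.2
      exact ih (by omega)
  obtain ⟨p⟩ := hP.preconnected ⟨f, hf⟩ ⟨g, hg⟩
  have h1 := hcon f hf
  have h2 := walk _ _ p (lt_of_le_of_ne hfv h1)
  simp only at h2
  omega

/-! ### Counting rows by their end sites. -/

/-- The site-perimeter faces of `P`. -/
noncomputable def sites (P : Finset Face) : Finset Face :=
  (P.image flipX ∪ P.image flipY ∪ P.image flipZ) \ P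

theorem mem_sites {P : Finset Face} {g : Face} :
    g ∈ sites P ↔ (flipX g ∈ P ∨ flipY g ∈ P ∨ flipZ g ∈ P) ∧ g ∉ P := by
  have aux : ∀ φ : Face → Face, (∀ f, φ (φ f) = f) → (g ∈ P.image φ ↔ φ g ∈ P) := by
    intro φ hφ
    rw [Finset.mem_image]
    constructor
    · rintro ⟨f, hf, rfl⟩
      rwa [hφ]
    · exact fun h => ⟨_, h, hφ g⟩
  rw [sites, Finset.mem_sdiff, Finset.mem_union, Finset.mem_union, aux _ flipX_flipX,
    aux _ flipY_flipY, aux _ flipZ_flipZ, or_assoc]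

theorem sitePerimeter_eq_card (P : Finset Face) : sitePerimeter P = (sites P).card := by
  rw [sitePerimeter, ← Set.ncard_coe_finset]
  congr 1
  ext g
  rw [Set.mem_ofPred_eq, Finset.mem_coe, mem_sites, and_comm]
  refine and_congr_left fun _ => ?_
  constructor
  · rintro ⟨f, hf, h⟩
    rcases (adj_iff _ _).1 h with rfl | rfl | rfl <;> simp [hf]
  · rintro (h | h | h)
    · exact ⟨_, h, (adj_iff _ _).2 (by simp)⟩
    · exact ⟨_, h, (adj_iff _ _).2 (by simp)⟩
    · exact ⟨_, h, (adj_iff _ _).2 (by simp)⟩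

/-- The faces outside `P` exactly one of whose images under `α` and `β` lies in `P`. -/
noncomputable def rowEnds (α β : Face → Face) (P : Finset Face) : Finset Face :=
  (sites P).filter fun g => ¬ (α g ∈ P ↔ β g ∈ P)

/-- If `α` and `β` are the two steps along the rows `ρ = const`, with positions in a row given by
`τ`, then every row that meets `P` contains two row ends. -/
theorem two_mul_card_image_le_card_rowEnds (P : Finset Face) (α β : Face → Face) (ρ τ : Face → ℤ)
    (hα : ∀ f, α (α f) = f) (hβ : ∀ f, β (β f) = f)
    (hραβ : ∀ f, ρ (α f) = ρ f ∧ ρ (β f) = ρ f)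
    (hτ : ∀ f, τ (α f) = τ f - 1 ∧ τ (β f) = τ f + 1 ∨ τ (α f) = τ f + 1 ∧ τ (β f) = τ f - 1)
    (hsite : ∀ g, α g ∈ P ∨ β g ∈ P → g ∉ P → g ∈ sites P) :
    2 * (P.image ρ).card ≤ (rowEnds α β P).card := by
  have hmaps : ∀ g ∈ rowEnds α β P, ρ g ∈ P.image ρ := by
    intro g hg
    rw [rowEnds, Finset.mem_filter] at hg
    rw [Finset.mem_image]
    by_cases h : α g ∈ P
    · exact ⟨_, h, (hραβ g).1⟩
    · have : β g ∈ P := by tauto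
      exact ⟨_, this, (hραβ g).2⟩
  refine Finset.mul_card_image_le_card_of_maps_to hmaps 2 fun v hv => ?_
  rw [Finset.mem_image] at hv
  have hne : (P.filter fun f => ρ f = v).Nonempty := by
    obtain ⟨f, hf, h⟩ := hv
    exact ⟨f, Finset.mem_filter.2 ⟨hf, h⟩⟩
  obtain ⟨m, hm, hmin⟩ := Finset.exists_min_image _ τ hne
  obtain ⟨M, hM, hmax⟩ := Finset.exists_max_image _ τ hne
  rw [Finset.mem_filter] at hm hM
  have hout : ∀ f, ρ f = v → τ f < τ m ∨ τ M < τ f → f ∉ P := by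
    intro f hf h hfP
    have h1 := hmin f (Finset.mem_filter.2 ⟨hfP, hf⟩)
    have h2 := hmax f (Finset.mem_filter.2 ⟨hfP, hf⟩)
    omega
  have hmM := hmin M (Finset.mem_filter.2 hM)
  -- Which of `α`, `β` decreases `τ` depends on the orientation of the face. The face just below `m`
  -- is outside `P`, and so is the next one, so exactly one of its two row neighbours is in `P`.
  have low : ∃ g ∈ rowEnds α β P, ρ g = v ∧ τ g = τ m - 1 := by
    have hrow := hραβ m
    rcases hτ m with h | h
    · have hn : α m ∉ P := hout _ (by omega) (by omega)
      have h' := hτ (α m)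
      have h'' := hραβ (α m)
      rw [hα] at h' h''
      have hn' : β (α m) ∉ P := hout _ (by omega) (by omega)
      refine ⟨α m, Finset.mem_filter.2 ⟨hsite _ (by rw [hα]; exact Or.inl hm.1) hn, ?_⟩,
        by omega, by omega⟩
      rw [hα]
      tauto
    · have hn : β m ∉ P := hout _ (by omega) (by omega)
      have h' := hτ (β m)
      have h'' := hραβ (β m)
      rw [hβ] at h' h''
      have hn' : α (β m) ∉ P := hout _ (by omega) (by omega)
      refine ⟨β m, Finset.mem_filter.2 ⟨hsite _ (by rw [hβ]; exact Or.inr hm.1) hn, ?_⟩,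
        by omega, by omega⟩
      rw [hβ]
      tauto
  have high : ∃ g ∈ rowEnds α β P, ρ g = v ∧ τ g = τ M + 1 := by
    have hrow := hραβ M
    rcases hτ M with h | h
    · have hn : β M ∉ P := hout _ (by omega) (by omega)
      have h' := hτ (β M)
      have h'' := hραβ (β M)
      rw [hβ] at h' h''
      have hn' : α (β M) ∉ P := hout _ (by omega) (by omega)
      refine ⟨β M, Finset.mem_filter.2 ⟨hsite _ (by rw [hβ]; exact Or.inr hM.1) hn, ?_⟩,
        by omega, by omega⟩
      rw [hβ]
      tauto
    · have hn : α M ∉ P := hout _ (by omega) (by omega)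
      have h' := hτ (α M)
      have h'' := hραβ (α M)
      rw [hα] at h' h''
      have hn' : β (α M) ∉ P := hout _ (by omega) (by omega)
      refine ⟨α M, Finset.mem_filter.2 ⟨hsite _ (by rw [hα]; exact Or.inl hM.1) hn, ?_⟩,
        by omega, by omega⟩
      rw [hα]
      tauto
  obtain ⟨g, hg, hg1, hg2⟩ := low
  obtain ⟨g', hg', hg1', hg2'⟩ := high
  have : 1 < ((rowEnds α β P).filter fun f => ρ f = v).card :=
    Finset.one_lt_card.2 ⟨g, Finset.mem_filter.2 ⟨hg, hg1⟩, g', Finset.mem_filter.2 ⟨hg', hg1'⟩,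
      fun h => by rw [h] at hg2; omega⟩
  omega

/-- The number of rows of the three kinds that meet `P` is at most its site-perimeter. -/
theorem card_rows_le_sitePerimeter (P : Finset Face) :
    (P.image fun f => f.1).card + (P.image fun f => f.2.1).card + (P.image third).card ≤
      sitePerimeter P := by
  have h1 := two_mul_card_image_le_card_rowEnds P flipY flipZ (fun f => f.1)
    (fun f => f.2.1 + third f) flipY_flipY flipZ_flipZ
    (by rintro ⟨x, y, _ | _⟩ <;> simp [flipY, flipZ])
    (by rintro ⟨x, y, _ | _⟩ <;> simp only [flipY, flipZ, third] <;> omega)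
    (fun g h h' => mem_sites.2 ⟨by tauto, h'⟩)
  have h2 := two_mul_card_image_le_card_rowEnds P flipX flipZ (fun f => f.2.1)
    (fun f => f.1 + third f) flipX_flipX flipZ_flipZ
    (by rintro ⟨x, y, _ | _⟩ <;> simp [flipX, flipZ])
    (by rintro ⟨x, y, _ | _⟩ <;> simp only [flipX, flipZ, third] <;> omega)
    (fun g h h' => mem_sites.2 ⟨by tauto, h'⟩)
  have h3 := two_mul_card_image_le_card_rowEnds P flipX flipY third
    (fun f => f.1 - f.2.1) flipX_flipX flipY_flipY
    (by rintro ⟨x, y, _ | _⟩ <;> simp only [flipX, flipY, third] <;> omega)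
    (by rintro ⟨x, y, _ | _⟩ <;> simp only [flipX, flipY] <;> omega)
    (fun g h h' => mem_sites.2 ⟨by tauto, h'⟩)
  -- The double count: a site is a row end in at most two of the three directions.
  have h4 : (rowEnds flipY flipZ P).card + (rowEnds flipX flipZ P).card +
      (rowEnds flipX flipY P).card ≤ 2 * (sites P).card := by
    simp only [rowEnds, Finset.card_filter]
    rw [← Finset.sum_add_distrib, ← Finset.sum_add_distrib, mul_comm, ← smul_eq_mul]
    refine Finset.sum_le_card_nsmul _ _ _ fun g _ => ?_
    by_cases hx : flipX g ∈ P <;> by_cases hy : flipY g ∈ P <;> by_cases hz : flipZ g ∈ P <;>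
      simp [hx, hy, hz]
  rw [sitePerimeter_eq_card]
  omega

/-! ### Site-perimeter and area of tight boxes; the bounding box of a polyiamond. -/

/-- The six sides of the region bounded by the given lines have nonnegative length. -/
def IsTight (x₀ x₁ y₀ y₁ z₀ z₁ : ℤ) : Prop :=
  x₀ + y₀ ≤ z₀ ∧ z₁ ≤ x₁ + y₁ ∧ z₀ ≤ x₀ + y₁ ∧ z₀ ≤ x₁ + y₀ ∧ x₁ + y₀ ≤ z₁ ∧ x₀ + y₁ ≤ z₁ ∧
    z₀ ≤ z₁

/-- Every site lies across a unit edge of one of the six sides, and the side lengths add up to the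
sum of the widths. The inequality suffices: for extremal regions equality is recovered from
`IsPolyiamond.area_le`. -/
theorem sitePerimeter_box_le {x₀ x₁ y₀ y₁ z₀ z₁ : ℤ} (h : IsTight x₀ x₁ y₀ y₁ z₀ z₁) :
    (sitePerimeter (box x₀ x₁ y₀ y₁ z₀ z₁) : ℤ) ≤ (x₁ - x₀) + (y₁ - y₀) + (z₁ - z₀) := by
  obtain ⟨h1, h2, h3, h4, h5, h6, -⟩ := h
  have hsub : sites (box x₀ x₁ y₀ y₁ z₀ z₁) ⊆
      (Finset.Ico (z₀ - x₀) y₁).image (fun y => ((x₀ - 1, y, false) : Face)) ∪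
      (Finset.Ico (z₀ - y₀) x₁).image (fun x => ((x, y₀ - 1, false) : Face)) ∪
      (Finset.Ico y₀ (z₁ - x₁)).image (fun y => ((x₁, y, true) : Face)) ∪
      (Finset.Ico x₀ (z₁ - y₁)).image (fun x => ((x, y₁, true) : Face)) ∪
      (Finset.Ico x₀ (z₀ - y₀)).image (fun x => ((x, z₀ - 1 - x, true) : Face)) ∪
      (Finset.Ico (z₁ - y₁) x₁).image (fun x => ((x, z₁ - 1 - x, false) : Face)) := by
    rintro ⟨x, y, _ | _⟩ hg
    · rw [mem_sites, mem_box, mem_box, mem_box, mem_box] at hg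
      simp only [flipX, flipY, flipZ, third] at hg
      simp only [Finset.mem_union, Finset.mem_image, Finset.mem_Ico, Prod.mk.injEq, and_true,
        Bool.true_eq_false, and_false, exists_false, or_false]
      by_cases hx : x = x₀ - 1
      · exact Or.inl (Or.inl ⟨y, by omega, by omega⟩)
      by_cases hy : y = y₀ - 1
      · exact Or.inl (Or.inr ⟨x, by omega, by omega⟩)
      · exact Or.inr ⟨x, by omega, by omega⟩
    · rw [mem_sites, mem_box, mem_box, mem_box, mem_box] at hg
      simp only [flipX, flipY, flipZ, third] at hg
      simp only [Finset.mem_union, Finset.mem_image, Finset.mem_Ico, Prod.mk.injEq, and_true,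
        Bool.false_eq_true, and_false, exists_false, or_false, false_or]
      by_cases hx : x = x₁
      · exact Or.inl (Or.inl ⟨y, by omega, by omega⟩)
      by_cases hy : y = y₁
      · exact Or.inl (Or.inr ⟨x, by omega, by omega⟩)
      · exact Or.inr ⟨x, by omega, by omega⟩
  have hcard := Finset.card_le_card hsub
  have hIco : ∀ (p q : ℤ) (φ : ℤ → Face), ((Finset.Ico p q).image φ).card ≤ (q - p).toNat :=
    fun p q φ => Finset.card_image_le.trans_eq (Int.card_Ico p q)
  have hle := hcard.trans <| (Finset.card_union_le _ _).trans <|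
    Nat.add_le_add ((Finset.card_union_le _ _).trans <|
    Nat.add_le_add ((Finset.card_union_le _ _).trans <|
    Nat.add_le_add ((Finset.card_union_le _ _).trans <|
    Nat.add_le_add ((Finset.card_union_le _ _).trans <|
    Nat.add_le_add (hIco _ _ _) (hIco _ _ _)) (hIco _ _ _)) (hIco _ _ _)) (hIco _ _ _))
    (hIco _ _ _)
  rw [sitePerimeter_eq_card]
  omega

theorem card_triangle (n : ℕ) : (triangle n).card = n ^ 2 := by
  induction n with
  | zero =>
    rw [sq, mul_zero, Finset.card_eq_zero, Finset.eq_empty_iff_forall_notMem]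
    intro f
    rw [triangle_eq_box, mem_box]
    lia
  | succ n ih =>
    have hsplit : triangle (n + 1) = triangle n ∪
        ((Finset.range (n + 1)).image (fun j : ℕ => (((j : ℤ), (n : ℤ) - j, true) : Face)) ∪
        (Finset.range n).image (fun j : ℕ => (((j : ℤ), (n : ℤ) - 1 - j, false) : Face))) := by
      ext ⟨x, y, _ | _⟩
      · rw [Finset.mem_union, Finset.mem_union, triangle_eq_box, triangle_eq_box, mem_box,
          mem_box]
        simp only [third, Finset.mem_image, Finset.mem_range, Prod.mk.injEq, and_true,
          Bool.true_eq_false, and_false, exists_false, false_or]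
        constructor
        · intro h
          by_cases hz : x + y + 1 < n
          · left; omega
          · right; exact ⟨x.toNat, by omega, by omega, by omega⟩
        · rintro (h | ⟨j, h⟩) <;> push_cast <;> omega
      · rw [Finset.mem_union, Finset.mem_union, triangle_eq_box, triangle_eq_box, mem_box,
          mem_box]
        simp only [third, Finset.mem_image, Finset.mem_range, Prod.mk.injEq, and_true,
          Bool.false_eq_true, and_false, exists_false, or_false]
        constructor
        · intro h
          by_cases hz : x + y < n
          · left; omega
          · right; exact ⟨x.toNat, by omega, by omega, by omega⟩
        · rintro (h | ⟨j, h⟩) <;> push_cast <;> omega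
    rw [hsplit, Finset.card_union_of_disjoint, Finset.card_union_of_disjoint,
      Finset.card_image_of_injective, Finset.card_image_of_injective, ih, Finset.card_range,
      Finset.card_range]
    · ring
    · intro i j h
      simpa using congrArg Prod.fst h
    · intro i j h
      simpa using congrArg Prod.fst h
    · rw [Finset.disjoint_left]
      rintro f hf hf'
      simp only [Finset.mem_image] at hf hf'
      obtain ⟨i, -, rfl⟩ := hf
      obtain ⟨j, -, h⟩ := hf'
      simp at h
    · rw [Finset.disjoint_left]
      intro f hf hf'
      rw [triangle_eq_box, mem_box] at hf
      simp only [Finset.mem_union, Finset.mem_image] at hf'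
      rcases hf' with ⟨j, -, rfl⟩ | ⟨j, -, rfl⟩ <;> simp only [third] at hf <;> omega

/-- The parallelogram given by the `x` and `y` bounds is the box together with two corner triangles,
of sides `z₀ - x₀ - y₀` and `x₁ + y₁ - z₁`. -/
theorem card_box {x₀ x₁ y₀ y₁ z₀ z₁ : ℤ} (h : IsTight x₀ x₁ y₀ y₁ z₀ z₁) :
    ((box x₀ x₁ y₀ y₁ z₀ z₁).card : ℤ) =
      2 * (x₁ - x₀) * (y₁ - y₀) - (z₀ - x₀ - y₀) ^ 2 - (x₁ + y₁ - z₁) ^ 2 := by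
  obtain ⟨h1, h2, h3, h4, h5, h6, h7⟩ := h
  obtain ⟨a, ha⟩ := Int.eq_ofNat_of_zero_le (show 0 ≤ z₀ - x₀ - y₀ by omega)
  obtain ⟨b, hb⟩ := Int.eq_ofNat_of_zero_le (show 0 ≤ x₁ + y₁ - z₁ by omega)
  have hlow : (triangle a).image (translate (x₀, y₀)) =
      box x₀ (x₀ + a) y₀ (y₀ + a) (x₀ + y₀) z₀ := by
    rw [triangle_eq_box, box_translate]
    congr 1 <;> simp only <;> omega
  have hhigh : (triangle b).image (move 3 (x₁, y₁)) =
      box (x₁ - b) x₁ (y₁ - b) y₁ z₁ (x₁ + y₁) := by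
    have hm : move 3 (x₁, y₁) = translate (x₁, y₁) ∘ rotate ∘ rotate ∘ rotate := rfl
    rw [hm, ← Finset.image_image, ← Finset.image_image, ← Finset.image_image, triangle_eq_box,
      box_rotate, box_rotate, box_rotate, box_translate]
    congr 1 <;> simp only <;> omega
  have hsplit : Finset.Ico x₀ x₁ ×ˢ Finset.Ico y₀ y₁ ×ˢ (Finset.univ : Finset Bool) =
      box x₀ x₁ y₀ y₁ z₀ z₁ ∪ ((triangle a).image (translate (x₀, y₀)) ∪
        (triangle b).image (move 3 (x₁, y₁))) := by
    rw [hlow, hhigh]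
    ext f
    have := third_mem f
    simp only [Finset.mem_union, mem_box, Finset.mem_product, Finset.mem_Ico, Finset.mem_univ,
      and_true]
    omega
  have hcard := congrArg Finset.card hsplit
  rw [Finset.card_union_of_disjoint, Finset.card_union_of_disjoint,
    Finset.card_image_of_injective _ (translate_injective _),
    Finset.card_image_of_injective _ (move_injective _ _), card_triangle, card_triangle,
    Finset.card_product, Finset.card_product, Int.card_Ico, Int.card_Ico, Finset.card_univ,
    Fintype.card_bool] at hcard
  · rw [ha, hb]
    have hx : ((x₁ - x₀).toNat : ℤ) = x₁ - x₀ := Int.toNat_of_nonneg (by omega)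
    have hy : ((y₁ - y₀).toNat : ℤ) = y₁ - y₀ := Int.toNat_of_nonneg (by omega)
    have hcard' := congrArg (Nat.cast : ℕ → ℤ) hcard
    push_cast [hx, hy] at hcard'
    linarith
  · rw [hlow, hhigh, Finset.disjoint_left]
    intro f hf hf'
    rw [mem_box] at hf hf'
    omega
  · rw [hlow, hhigh, Finset.disjoint_left]
    intro f hf hf'
    rw [Finset.mem_union, mem_box, mem_box] at hf'
    rw [mem_box] at hf
    omega

/-- Every polyiamond lies in a region cut out by lines with tight sides, whose widths sum up to at
most the site-perimeter. -/
theorem IsPolyiamond.exists_box {P : Finset Face} (hP : IsPolyiamond P) :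
    ∃ x₀ x₁ y₀ y₁ z₀ z₁ : ℤ, P ⊆ box x₀ x₁ y₀ y₁ z₀ z₁ ∧ IsTight x₀ x₁ y₀ y₁ z₀ z₁ ∧
      (x₀ < x₁ ∧ y₀ < y₁ ∧ z₀ < z₁) ∧
      (x₁ - x₀) + (y₁ - y₀) + (z₁ - z₀) ≤ (sitePerimeter P : ℤ) := by
  have rows : ∀ ρ : Face → ℤ, (∀ f g, faceGraph.Adj f g → ρ g ≤ ρ f + 1) →
      ∃ m ∈ P, ∃ M ∈ P, (∀ f ∈ P, ρ m ≤ ρ f ∧ ρ f ≤ ρ M) ∧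
        ρ M + 1 - ρ m ≤ ((P.image ρ).card : ℤ) := by
    intro ρ hρ
    obtain ⟨m, hm, hmin⟩ := Finset.exists_min_image P ρ hP.nonempty
    obtain ⟨M, hM, hmax⟩ := Finset.exists_max_image P ρ hP.nonempty
    refine ⟨m, hm, M, hM, fun f hf => ⟨hmin f hf, hmax f hf⟩, ?_⟩
    -- Connectedness leaves no gap between the extreme rows, so the width is at most the number of
    -- occupied rows.
    have hsub : Finset.Icc (ρ m) (ρ M) ⊆ P.image ρ := by
      intro v hv
      rw [Finset.mem_Icc] at hv
      rw [Finset.mem_image]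
      exact hP.exists_coord_eq ρ hρ hm hM hv.1 hv.2
    have hcard := Finset.card_le_card hsub
    rw [Int.card_Icc] at hcard
    omega
  have step : ∀ ρ : Face → ℤ, (∀ f, ρ (flipX f) ≤ ρ f + 1 ∧ ρ (flipY f) ≤ ρ f + 1 ∧
      ρ (flipZ f) ≤ ρ f + 1) → ∀ f g, faceGraph.Adj f g → ρ g ≤ ρ f + 1 := by
    intro ρ h f g hfg
    rcases (adj_iff _ _).1 hfg with rfl | rfl | rfl
    · exact (h f).1
    · exact (h f).2.1
    · exact (h f).2.2
  obtain ⟨a, ha, A, hA, hx, hxc⟩ := rows (fun f => f.1) (step _ (by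
    rintro ⟨x, y, _ | _⟩ <;> simp only [flipX, flipY, flipZ] <;> omega))
  obtain ⟨b, hb, B, hB, hy, hyc⟩ := rows (fun f => f.2.1) (step _ (by
    rintro ⟨x, y, _ | _⟩ <;> simp only [flipX, flipY, flipZ] <;> omega))
  obtain ⟨c, hc, C, hC, hz, hzc⟩ := rows third (step _ (by
    rintro ⟨x, y, _ | _⟩ <;> simp only [flipX, flipY, flipZ, third] <;> omega))
  have hs := card_rows_le_sitePerimeter P
  refine ⟨a.1, A.1 + 1, b.2.1, B.2.1 + 1, third c, third C + 1, ?_, ?_, ?_, by omega⟩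
  · intro f hf
    rw [mem_box]
    have h1 := hx f hf
    have h2 := hy f hf
    have h3 := hz f hf
    omega
  -- Each side condition is read off at a face in an extreme row. For instance `x₀ + y₀ ≤ z₀` holds
  -- because `c` has least third coordinate and `third c ≥ c.1 + c.2.1`.
  · have ta := third_mem a
    have tA := third_mem A
    have tb := third_mem b
    have tB := third_mem B
    have tc := third_mem c
    have tC := third_mem C
    have xb := hx b hb
    have xB := hx B hB
    have xc := hx c hc
    have xC := hx C hC
    have ya := hy a ha
    have yA := hy A hA
    have yc := hy c hc
    have yC := hy C hC
    have za := hz a ha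
    have zA := hz A hA
    have zb := hz b hb
    have zB := hz B hB
    refine ⟨?_, ?_, ?_, ?_, ?_, ?_, ?_⟩ <;> omega
  · have h1 := hx a ha
    have h2 := hy a ha
    have h3 := hz a ha
    omega

/-! ### Shape parameters and the isoperimetric deficit. -/

/-- `P` is a region whose widths have sum `S` and consecutive differences `d`, `e`, and whose
midlines miss a common point by `D / 2`. -/
def HasShape (S d e D : ℤ) (P : Finset Face) : Prop :=
  ∃ x₀ x₁ y₀ y₁ z₀ z₁ : ℤ, (x₁ - x₀) + (y₁ - y₀) + (z₁ - z₀) = S ∧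
    (x₁ - x₀) - (y₁ - y₀) = d ∧ (y₁ - y₀) - (z₁ - z₀) = e ∧
    z₀ + z₁ - x₀ - x₁ - y₀ - y₁ = D ∧ P = box x₀ x₁ y₀ y₁ z₀ z₁

/-- The isoperimetric deficit `S ^ 2 - 6 * area` of a region with shape parameters `d`, `e`, `D`. -/
def deficit (d e D : ℤ) : ℤ := 2 * (d ^ 2 + e ^ 2 + (d + e) ^ 2) + 3 * D ^ 2

/-- The least isoperimetric deficit for perimeters congruent to `i` modulo `6`. -/
def minDeficit : ℕ → ℤ
  | 0 => 0
  | 1 => 7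
  | 2 => 4
  | 3 => 3
  | 4 => 4
  | 5 => 7
  | _ => 0

/-- A region with perimeter `6 * r + i` and least deficit. -/
def IsExtremal (r i : ℕ) (P : Finset Face) : Prop :=
  ∃ d e D : ℤ, HasShape (6 * r + i) d e D P ∧ deficit d e D = minDeficit i

theorem HasShape.rotate {S d e D : ℤ} {P : Finset Face} (h : HasShape S d e D P) :
    HasShape S e (-(d + e)) (-D) (P.image rotate) := by
  obtain ⟨x₀, x₁, y₀, y₁, z₀, z₁, h1, h2, h3, h4, rfl⟩ := h
  exact ⟨-y₁, -y₀, z₀, z₁, x₀, x₁, by omega, by omega, by omega, by omega, box_rotate ..⟩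

theorem HasShape.translate {S d e D : ℤ} {P : Finset Face} (h : HasShape S d e D P)
    (t : ℤ × ℤ) : HasShape S d e D (P.image (translate t)) := by
  obtain ⟨x₀, x₁, y₀, y₁, z₀, z₁, h1, h2, h3, h4, rfl⟩ := h
  exact ⟨_, _, _, _, _, _, by omega, by omega, by omega, by omega, box_translate ..⟩

/-- `S`, `d`, `e` determine the three widths, and `D` then determines `z₀` relative to `x₀` and
`y₀`. -/
theorem HasShape.exists_translate {S d e D : ℤ} {P Q : Finset Face} (hP : HasShape S d e D P)
    (hQ : HasShape S d e D Q) : ∃ t, Q = P.image (TriLattice.translate t) := by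
  obtain ⟨x₀, x₁, y₀, y₁, z₀, z₁, h1, h2, h3, h4, rfl⟩ := hP
  obtain ⟨x₀', x₁', y₀', y₁', z₀', z₁', h1', h2', h3', h4', rfl⟩ := hQ
  refine ⟨(x₀' - x₀, y₀' - y₀), ?_⟩
  rw [box_translate]
  congr 1 <;> simp only <;> omega

/-- The deficit is at least three times each of `d ^ 2`, `e ^ 2`, `(d + e) ^ 2` and `D ^ 2`, so a
parameter of absolute value 2 would cost at least 12. The threshold 7 is the largest value of
`minDeficit`. -/
theorem abs_le_one_of_deficit_le {d e D : ℤ} (h : deficit d e D ≤ 7) :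
    (-1 ≤ d ∧ d ≤ 1) ∧ (-1 ≤ e ∧ e ≤ 1) ∧ (-1 ≤ D ∧ D ≤ 1) ∧ -1 ≤ d + e ∧ d + e ≤ 1 := by
  unfold deficit at h
  have bound : ∀ x : ℤ, x ^ 2 < 2 ^ 2 → -1 ≤ x ∧ x ≤ 1 := by
    intro x hx
    have := abs_lt_of_sq_lt_sq' hx (by norm_num)
    omega
  have h1 : d ^ 2 < 2 ^ 2 := by nlinarith [sq_nonneg (d + 2 * e), sq_nonneg D]
  have h2 : e ^ 2 < 2 ^ 2 := by nlinarith [sq_nonneg (2 * d + e), sq_nonneg D]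
  have h3 : D ^ 2 < 2 ^ 2 := by nlinarith [sq_nonneg d, sq_nonneg e, sq_nonneg (d + e)]
  have h4 : (d + e) ^ 2 < 2 ^ 2 := by nlinarith [sq_nonneg (d - e), sq_nonneg D]
  exact ⟨bound _ h1, bound _ h2, bound _ h3, bound _ h4⟩

theorem minDeficit_le (i : ℕ) : minDeficit i ≤ 7 := by
  unfold minDeficit
  split <;> norm_num

/-- Each side length is `S / 6` up to an error of at most `2 / 3 + 1 / 2`, coming from the widths
and from `D`. With `6 ≤ S` this integer exceeds `-1`, hence is nonnegative. -/
theorem HasShape.exists_box {S d e D : ℤ} {P : Finset Face} (h : HasShape S d e D P)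
    (hS : 6 ≤ S) (hd : deficit d e D ≤ 7) :
    ∃ x₀ x₁ y₀ y₁ z₀ z₁ : ℤ, IsTight x₀ x₁ y₀ y₁ z₀ z₁ ∧
      (x₁ - x₀) + (y₁ - y₀) + (z₁ - z₀) = S ∧ (x₁ - x₀) - (y₁ - y₀) = d ∧
      (y₁ - y₀) - (z₁ - z₀) = e ∧ z₀ + z₁ - x₀ - x₁ - y₀ - y₁ = D ∧
      P = box x₀ x₁ y₀ y₁ z₀ z₁ := by
  obtain ⟨x₀, x₁, y₀, y₁, z₀, z₁, h1, h2, h3, h4, rfl⟩ := h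
  obtain ⟨h5, h6, h7, h8⟩ := abs_le_one_of_deficit_le hd
  refine ⟨x₀, x₁, y₀, y₁, z₀, z₁, ?_, h1, h2, h3, h4, rfl⟩
  refine ⟨?_, ?_, ?_, ?_, ?_, ?_, ?_⟩ <;> omega

theorem sq_eq_card_add_deficit {x₀ x₁ y₀ y₁ z₀ z₁ : ℤ} (h : IsTight x₀ x₁ y₀ y₁ z₀ z₁) :
    ((x₁ - x₀) + (y₁ - y₀) + (z₁ - z₀)) ^ 2 = 6 * ((box x₀ x₁ y₀ y₁ z₀ z₁).card : ℤ) +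
      deficit ((x₁ - x₀) - (y₁ - y₀)) ((y₁ - y₀) - (z₁ - z₀))
        (z₀ + z₁ - x₀ - x₁ - y₀ - y₁) := by
  rw [card_box h, deficit]
  ring

theorem HasShape.card {S d e D : ℤ} {P : Finset Face} (h : HasShape S d e D P)
    (hS : 6 ≤ S) (hd : deficit d e D ≤ 7) : S ^ 2 = 6 * (P.card : ℤ) + deficit d e D := by
  obtain ⟨x₀, x₁, y₀, y₁, z₀, z₁, ht, h1, h2, h3, h4, rfl⟩ := h.exists_box hS hd
  rw [← h1, ← h2, ← h3, ← h4]
  exact sq_eq_card_add_deficit ht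

theorem HasShape.isPolyiamond {S d e D : ℤ} {P : Finset Face} (h : HasShape S d e D P)
    (hS : 6 ≤ S) (hd : deficit d e D ≤ 7) : IsPolyiamond P := by
  have hcard := h.card hS hd
  obtain ⟨x₀, x₁, y₀, y₁, z₀, z₁, -, -, -, -, -, rfl⟩ := h.exists_box hS hd
  apply isPolyiamond_box
  rw [← Finset.card_pos]
  have : (0 : ℤ) < (box x₀ x₁ y₀ y₁ z₀ z₁).card := by nlinarith
  exact_mod_cast this

theorem HasShape.sitePerimeter_le {S d e D : ℤ} {P : Finset Face} (h : HasShape S d e D P)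
    (hS : 6 ≤ S) (hd : deficit d e D ≤ 7) : (sitePerimeter P : ℤ) ≤ S := by
  obtain ⟨x₀, x₁, y₀, y₁, z₀, z₁, ht, h1, -, -, -, rfl⟩ := h.exists_box hS hd
  rw [← h1]
  exact sitePerimeter_box_le ht

theorem isRegularHexagon_iff {r : ℕ} {P : Finset Face} :
    IsRegularHexagon r P ↔ HasShape (6 * r) 0 0 0 P := by
  have hhex : HasShape (6 * r) 0 0 0 (hexagon r) :=
    ⟨-r, r, -r, r, -r, r, by omega, by omega, by omega, by omega, hexagon_eq_box r⟩
  constructor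
  · rintro ⟨t, rfl⟩
    exact hhex.translate t
  · intro h
    exact hhex.exists_translate h

theorem HasShape.exists_hexagon {S d e D : ℤ} {P : Finset Face} (h : HasShape S d e D P) {r : ℕ}
    (hS : S ≤ 6 * r) (hd : deficit d e D ≤ 7) : ∃ H, IsRegularHexagon r H ∧ P ⊆ H := by
  obtain ⟨x₀, x₁, y₀, y₁, z₀, z₁, h1, h2, h3, h4, rfl⟩ := h
  obtain ⟨h5, h6, h7, h8⟩ := abs_le_one_of_deficit_le hd
  -- The centre `(s, t)` is chosen greedily: `s` is least subject to `x₁ ≤ s + r` and to leaving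
  -- room for some `t ≤ y₀ + r` with `z₁ ≤ s + t + r`; then `t` is least.
  obtain ⟨s, hs⟩ : ∃ s, s = max (x₁ - r) (z₁ - y₀ - 2 * r) := ⟨_, rfl⟩
  obtain ⟨t, ht⟩ : ∃ t, t = max (y₁ - r) (z₁ - r - s) := ⟨_, rfl⟩
  refine ⟨box (s - r) (s + r) (t - r) (t + r) (s + t - r) (s + t + r),
    isRegularHexagon_iff.2 ⟨_, _, _, _, _, _, by omega, by omega, by omega, by omega, rfl⟩, ?_⟩
  intro f hf
  rw [mem_box] at hf ⊢
  refine ⟨⟨?_, ?_⟩, ⟨?_, ?_⟩, ?_, ?_⟩ <;> omega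

/-! ### Composition and inverses of lattice motions, and invariance under them. -/

theorem move_zero : move 0 0 = id := by
  funext f
  simp [move, translate_zero]

theorem translate_comp_move (s : ℤ × ℤ) (k : ℕ) (t : ℤ × ℤ) :
    translate s ∘ move k t = move k (t + s) := by
  funext f
  exact translate_translate _ _ _

theorem rotate_comp_move (k : ℕ) (t : ℤ × ℤ) :
    rotate ∘ move k t = move (k + 1) (-t.2, t.1 + t.2) := by
  funext f
  simp only [move, Function.comp, rotate_translate, Function.iterate_succ_apply']

theorem exists_iterate_rotate_comp_move (j k : ℕ) (t : ℤ × ℤ) :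
    ∃ t', rotate^[j] ∘ move k t = move (k + j) t' := by
  induction j with
  | zero => exact ⟨t, rfl⟩
  | succ j ih =>
    obtain ⟨t', h⟩ := ih
    rw [Function.iterate_succ', Function.comp_assoc, h, rotate_comp_move]
    exact ⟨_, rfl⟩

theorem exists_move_comp_move (k k' : ℕ) (t t' : ℤ × ℤ) :
    ∃ k'' t'', move k t ∘ move k' t' = move k'' t'' := by
  obtain ⟨s, h⟩ := exists_iterate_rotate_comp_move k k' t'
  refine ⟨k' + k, s + t, ?_⟩
  rw [← translate_comp_move, ← h]
  rfl

theorem iterate_rotate_six_mul (k : ℕ) : rotate^[6 * k] = id := by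
  rw [Function.iterate_mul, show rotate^[6] = id from funext rotate_six, Function.iterate_id]

theorem exists_move_comp_eq_id (k : ℕ) (t : ℤ × ℤ) :
    ∃ k' t', move k' t' ∘ move k t = id := by
  obtain ⟨s, h⟩ := exists_iterate_rotate_comp_move (5 * k) k t
  refine ⟨5 * k, -s, ?_⟩
  have : move (5 * k) (-s) ∘ move k t = translate (-s) ∘ rotate^[5 * k] ∘ move k t := rfl
  rw [this, h, translate_comp_move, add_neg_cancel, show k + 5 * k = 6 * k by ring]
  funext f
  rw [move, iterate_rotate_six_mul, translate_zero]
  rfl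

theorem image_move (k : ℕ) (t : ℤ × ℤ) (P : Finset Face) :
    P.image (move k t) = (P.image rotate^[k]).image (translate t) := by
  rw [Finset.image_image]
  rfl

theorem image_iterate_rotate_succ (k : ℕ) (P : Finset Face) :
    P.image rotate^[k + 1] = (P.image rotate^[k]).image rotate := by
  rw [Finset.image_image, Function.iterate_succ']

theorem IsExtremal.rotate {r i : ℕ} {P : Finset Face} (h : IsExtremal r i P) :
    IsExtremal r i (P.image rotate) := by
  obtain ⟨d, e, D, h, h'⟩ := h
  refine ⟨_, _, _, h.rotate, ?_⟩
  rw [← h', deficit, deficit]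
  ring

theorem IsExtremal.move {r i : ℕ} {P : Finset Face} (h : IsExtremal r i P) (k : ℕ) (t : ℤ × ℤ) :
    IsExtremal r i (P.image (move k t)) := by
  have hrot : IsExtremal r i (P.image TriLattice.rotate^[k]) := by
    induction k with
    | zero => simpa using h
    | succ k ih =>
      rw [image_iterate_rotate_succ]
      exact ih.rotate
  rw [image_move]
  obtain ⟨d, e, D, h, h'⟩ := hrot
  exact ⟨d, e, D, h.translate t, h'⟩

theorem AttachBar.move {l : ℕ} {Q P : Finset Face} (h : AttachBar l Q P) (k : ℕ) (t : ℤ × ℤ) :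
    AttachBar l (Q.image (move k t)) (P.image (move k t)) := by
  obtain ⟨k', t', h1, h2, rfl⟩ := h
  obtain ⟨k'', t'', h3⟩ := exists_move_comp_move k k' t t'
  refine ⟨k'', t'', ?_, ?_, ?_⟩
  · rw [← h3, ← Finset.image_image]
    exact Finset.image_subset_image h1
  · rw [← h3, ← Finset.image_image]
    exact (Finset.disjoint_image (move_injective k t)).2 h2
  · rw [Finset.image_union, ← h3, Finset.image_image]

theorem IsRegularHexagon.move {r : ℕ} {P : Finset Face} (h : IsRegularHexagon r P) (k : ℕ)
    (t : ℤ × ℤ) : IsRegularHexagon r (P.image (move k t)) := by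
  rw [isRegularHexagon_iff] at h ⊢
  have hrot : HasShape (6 * r) 0 0 0 (P.image rotate^[k]) := by
    induction k with
    | zero => simpa using h
    | succ k ih =>
      rw [image_iterate_rotate_succ]
      exact ih.rotate
  rw [image_move]
  exact hrot.translate t

theorem IsEB.move {r i : ℕ} {P : Finset Face} (h : IsEB r i P) (k : ℕ) (t : ℤ × ℤ) :
    IsEB r i (P.image (move k t)) := by
  induction i generalizing P with
  | zero => exact IsRegularHexagon.move h k t
  | succ i ih =>
    obtain ⟨⟨Q, hQ, hQP⟩, H, hH, hPH⟩ := h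
    exact ⟨⟨_, ih hQ, hQP.move k t⟩, _, hH.move k t, Finset.image_subset_image hPH⟩

/-! ### Attaching and removing bars. -/

/-- The difference between `barLength r i` and `r`. -/
def barExtra (i : ℕ) : ℤ := if i = 0 then 0 else if i = 5 then 2 else 1

theorem barLength_eq (r i : ℕ) : (barLength r i : ℤ) = r + barExtra i := by
  unfold barLength barExtra
  split_ifs <;> push_cast <;> ring

/-- For perimeter `6 * r + i`, the side on `y = y₁` has length `r + (i + 3 * D + 2 * d - 2 * e) /
6`. So a bar that fits along this side must cover it entirely, and raising `y₁` by 1 changes the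
parameters to `(d - 1, e + 1, D - 1)`. -/
theorem deficit_attach : ∀ i ∈ List.range 6, ∀ d ∈ ([-1, 0, 1] : List ℤ),
    ∀ e ∈ ([-1, 0, 1] : List ℤ), ∀ D ∈ ([-1, 0, 1] : List ℤ),
    deficit d e D = minDeficit i → (i - d + e) % 3 = 0 →
    6 * barExtra i ≤ i + 3 * D + 2 * d - 2 * e →
    deficit (d - 1) (e + 1) (D - 1) = minDeficit (i + 1) ∧
      i + 3 * D + 2 * d - 2 * e = 6 * barExtra i := by
  decide +kernel

/-- The shape parameters allow to remove a bar from the upper side of the region. -/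
def CanRemove (i : ℕ) (t : ℤ × ℤ × ℤ) : Prop :=
  deficit (t.1 + 1) (t.2.1 - 1) (t.2.2 + 1) = minDeficit i ∧
    i + 3 * t.2.2 + 2 * t.1 - 2 * t.2.1 + 7 = 6 * barExtra i

instance (i : ℕ) (t : ℤ × ℤ × ℤ) : Decidable (CanRemove i t) :=
  inferInstanceAs (Decidable (_ ∧ _))

/-- The effect of a rotation on the shape parameters. -/
def rotateParams (t : ℤ × ℤ × ℤ) : ℤ × ℤ × ℤ := (t.2.1, -(t.1 + t.2.1), -t.2.2)

/-- After a suitable rotation, the top row is a bar whose removal leaves least deficit. The constant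
7 in `CanRemove` is `3 + 2 + 2`, from evaluating the side length of `deficit_attach` at `(d + 1, e -
1, D + 1)`. -/
theorem exists_canRemove : ∀ i ∈ List.range 6, ∀ d ∈ ([-1, 0, 1] : List ℤ),
    ∀ e ∈ ([-1, 0, 1] : List ℤ), ∀ D ∈ ([-1, 0, 1] : List ℤ),
    deficit d e D = minDeficit (i + 1) → (i + 1 - d + e) % 3 = 0 →
    ∃ k ∈ List.range 6, CanRemove i (rotateParams^[k] (d, e, D)) := by
  decide +kernel

/-- The optimal triples for a given residue form a single orbit; this is the source of uniqueness up
to congruence. -/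
theorem exists_rotateParams_eq : ∀ i ∈ List.range 6, ∀ d ∈ ([-1, 0, 1] : List ℤ),
    ∀ e ∈ ([-1, 0, 1] : List ℤ), ∀ D ∈ ([-1, 0, 1] : List ℤ),
    deficit d e D = minDeficit i → (i - d + e) % 3 = 0 →
    ∀ d' ∈ ([-1, 0, 1] : List ℤ), ∀ e' ∈ ([-1, 0, 1] : List ℤ), ∀ D' ∈ ([-1, 0, 1] : List ℤ),
    deficit d' e' D' = minDeficit i → (i - d' + e') % 3 = 0 →
    ∃ k ∈ List.range 6, rotateParams^[k] (d, e, D) = (d', e', D') := by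
  decide +kernel

theorem HasShape.iterate_rotate {S : ℤ} {t : ℤ × ℤ × ℤ} {P : Finset Face}
    (h : HasShape S t.1 t.2.1 t.2.2 P) (k : ℕ) :
    HasShape S (rotateParams^[k] t).1 (rotateParams^[k] t).2.1 (rotateParams^[k] t).2.2
      (P.image TriLattice.rotate^[k]) := by
  induction k with
  | zero => simpa using h
  | succ k ih =>
    rw [image_iterate_rotate_succ, Function.iterate_succ_apply']
    exact ih.rotate

theorem HasShape.emod_three {S d e D : ℤ} {P : Finset Face} (h : HasShape S d e D P) :
    (S - d + e) % 3 = 0 := by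
  obtain ⟨x₀, x₁, y₀, y₁, z₀, z₁, h1, h2, h3, h4, rfl⟩ := h
  omega

theorem mem_params_of_deficit_eq {i : ℕ} {d e D : ℤ} (h : deficit d e D = minDeficit i) :
    d ∈ ([-1, 0, 1] : List ℤ) ∧ e ∈ ([-1, 0, 1] : List ℤ) ∧ D ∈ ([-1, 0, 1] : List ℤ) := by
  obtain ⟨h1, h2, h3, -⟩ := abs_le_one_of_deficit_le (h.trans_le (minDeficit_le i))
  simp only [List.mem_cons, List.not_mem_nil, or_false]
  omega

/-- Attaching a bar of the right length to an extremal region gives an extremal region. -/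
theorem IsExtremal.attach_standard {r i : ℕ} (hr : 1 ≤ r) (hi : i ≤ 5) {Q : Finset Face}
    (hQ : IsExtremal r i Q) (hsub : underBar (barLength r i) ⊆ Q)
    (hdisj : Disjoint Q (bar (barLength r i))) :
    IsExtremal r (i + 1) (Q ∪ bar (barLength r i)) := by
  obtain ⟨d, e, D, hshape, hdef⟩ := hQ
  have hmod := hshape.emod_three
  obtain ⟨hd, he, hD⟩ := mem_params_of_deficit_eq hdef
  have hdle := hdef.trans_le (minDeficit_le i)
  obtain ⟨x₀, x₁, y₀, y₁, z₀, z₁, ⟨t1, t2, t3, t4, t5, t6, -⟩, h1, h2, h3, h4, rfl⟩ :=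
    hshape.exists_box (by omega) hdle
  have hl : (barLength r i : ℤ) = r + barExtra i := barLength_eq r i
  have hl1 : 1 ≤ barLength r i := by unfold barLength; split_ifs <;> omega
  generalize barLength r i = l at *
  -- Three faces locate the bar: the two ends of `underBar l` lie in the box, while the bar's first
  -- face does not. This gives `y₁ = 0` and shows that the top side has length at least `l`.
  have m0 := hsub (mem_underBar.2 (show 0 ≤ ((0, -1, false) : Face).1 ∧ _ ∧ _ ∧ _ from
    ⟨le_rfl, by simp only; omega, rfl, rfl⟩))
  have m1 := hsub (mem_underBar.2 (show 0 ≤ (((l : ℤ) - 1, -1, false) : Face).1 ∧ _ ∧ _ ∧ _ from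
    ⟨by simp only; omega, by simp only; omega, rfl, by simp only [third]; ring⟩))
  have m2 : ((0, 0, true) : Face) ∉ box x₀ x₁ y₀ y₁ z₀ z₁ := by
    rw [Finset.disjoint_right] at hdisj
    apply hdisj
    rw [bar_eq_box hl1, mem_box]
    simp only [third]
    omega
  rw [mem_box] at m0 m1 m2
  simp only [third] at m0 m1 m2
  obtain ⟨n1, n2⟩ := deficit_attach i (List.mem_range.2 (by omega)) d hd e he D hD hdef
    (by omega) (by omega)
  refine ⟨d - 1, e + 1, D - 1, ⟨x₀, x₁, y₀, 1, z₀, z₁, by push_cast; omega, by omega, by omega,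
    by omega, ?_⟩, n1⟩
  rw [bar_eq_box hl1]
  ext f
  have hf := third_mem f
  rw [Finset.mem_union, mem_box, mem_box, mem_box]
  omega

theorem IsExtremal.attachBar {r i : ℕ} (hr : 1 ≤ r) (hi : i ≤ 5) {Q P : Finset Face}
    (hQ : IsExtremal r i Q) (h : AttachBar (barLength r i) Q P) : IsExtremal r (i + 1) P := by
  obtain ⟨k, t, h1, h2, rfl⟩ := h
  obtain ⟨k', t', h3⟩ := exists_move_comp_eq_id k t
  obtain ⟨k'', t'', h4⟩ := exists_move_comp_eq_id k' t'
  have hback : ∀ R : Finset Face, (R.image (TriLattice.move k t)).image (TriLattice.move k' t') = R := by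
    intro R
    rw [Finset.image_image, h3, Finset.image_id]
  have h5 := Finset.image_subset_image (f := TriLattice.move k' t') h1
  have h6 := (Finset.disjoint_image (move_injective k' t')).2 h2
  rw [hback] at h5 h6
  have h7 := ((hQ.move k' t').attach_standard hr hi h5 h6).move k'' t''
  rw [Finset.image_union, Finset.image_image, h4, Finset.image_id] at h7
  convert h7 using 2
  rw [← hback (bar _), Finset.image_image (g := TriLattice.move k'' t''), h4, Finset.image_id, hback]

theorem IsEB.isExtremal {r i : ℕ} (hr : 1 ≤ r) (hi : i ≤ 6) {P : Finset Face}
    (h : IsEB r i P) : IsExtremal r i P := by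
  induction i generalizing P with
  | zero =>
    have := isRegularHexagon_iff.1 h
    exact ⟨0, 0, 0, by simpa using this, by simp [deficit, minDeficit]⟩
  | succ i ih =>
    obtain ⟨⟨Q, hQ, hQP⟩, -⟩ := h
    exact (ih (by omega) hQ).attachBar hr (by omega) hQP

/-- The normalisation `x₀ = 0`, `y₁ = 1` puts the removable row in the standard position of `bar`;
the length condition in `CanRemove` then gives `z₁ = barLength r i`. -/
theorem isEB_succ_of_canRemove {r i : ℕ} (hr : 1 ≤ r) (hi : i ≤ 5)
    (ih : ∀ Q, IsExtremal r i Q → IsEB r i Q) {t : ℤ × ℤ × ℤ} (ht : CanRemove i t)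
    (hdef : deficit t.1 t.2.1 t.2.2 = minDeficit (i + 1))
    {x₁ y₀ z₀ z₁ : ℤ} (h1 : x₁ + (1 - y₀) + (z₁ - z₀) = 6 * r + (i + 1 : ℕ))
    (h2 : x₁ - (1 - y₀) = t.1) (h3 : (1 - y₀) - (z₁ - z₀) = t.2.1)
    (h4 : z₀ + z₁ - x₁ - y₀ - 1 = t.2.2) :
    IsEB r (i + 1) (box 0 x₁ y₀ 1 z₀ z₁) := by
  obtain ⟨d, e, D⟩ := t
  obtain ⟨n1, n2⟩ := ht
  simp only at *
  have hdle := hdef.trans_le (minDeficit_le (i + 1))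
  obtain ⟨k1, k2, k3, k4⟩ := abs_le_one_of_deficit_le hdle
  have hshape : HasShape (6 * r + (i + 1 : ℕ)) d e D (box 0 x₁ y₀ 1 z₀ z₁) :=
    ⟨0, x₁, y₀, 1, z₀, z₁, by omega, by omega, by omega, by omega, rfl⟩
  obtain ⟨m1, m2, m3, m4⟩ := abs_le_one_of_deficit_le (n1.trans_le (minDeficit_le i))
  refine ⟨⟨box 0 x₁ y₀ 0 z₀ z₁, ih _ ⟨d + 1, e - 1, D + 1, ⟨0, x₁, y₀, 0, z₀, z₁, by omega,
    by omega, by omega, by omega, rfl⟩, n1⟩, ?_⟩,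
    hshape.exists_hexagon (r := r + 1) (by push_cast; omega) hdle⟩
  have hl : (barLength r i : ℤ) = r + barExtra i := barLength_eq r i
  have hl1 : 1 ≤ barLength r i := by unfold barLength; split_ifs <;> omega
  generalize barLength r i = l at *
  refine ⟨0, 0, ?_, ?_, ?_⟩
  · rw [move_zero, Finset.image_id]
    intro f hf
    rw [mem_underBar] at hf
    rw [mem_box]
    omega
  · rw [move_zero, Finset.image_id, bar_eq_box hl1, Finset.disjoint_left]
    intro f hf hf'
    rw [mem_box] at hf hf'
    omega
  · rw [move_zero, Finset.image_id, bar_eq_box hl1]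
    ext f
    have hf := third_mem f
    rw [Finset.mem_union, mem_box, mem_box, mem_box]
    omega

theorem IsExtremal.isEB {r i : ℕ} (hr : 1 ≤ r) (hi : i ≤ 6) {P : Finset Face}
    (h : IsExtremal r i P) : IsEB r i P := by
  induction i generalizing P with
  | zero =>
    obtain ⟨d, e, D, hshape, hdef⟩ := h
    have hzero : d = 0 ∧ e = 0 ∧ D = 0 := by
      simp only [deficit, minDeficit] at hdef
      refine ⟨?_, ?_, ?_⟩ <;> rw [← sq_eq_zero_iff] <;>
        nlinarith [sq_nonneg d, sq_nonneg e, sq_nonneg (d + e), sq_nonneg D]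
    obtain ⟨rfl, rfl, rfl⟩ := hzero
    exact isRegularHexagon_iff.2 (by simpa using hshape)
  | succ i ih =>
    obtain ⟨d, e, D, hshape, hdef⟩ := h
    have hmod := hshape.emod_three
    obtain ⟨hd, he, hD⟩ := mem_params_of_deficit_eq hdef
    obtain ⟨k, -, hk⟩ := exists_canRemove i (List.mem_range.2 (by omega)) d hd e he D hD hdef
      (by omega)
    have hdef' : ∀ j, deficit (rotateParams^[j] (d, e, D)).1 (rotateParams^[j] (d, e, D)).2.1
        (rotateParams^[j] (d, e, D)).2.2 = minDeficit (i + 1) := by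
      intro j
      induction j with
      | zero => exact hdef
      | succ j ihj =>
        rw [Function.iterate_succ_apply', ← ihj]
        simp only [rotateParams, deficit]
        ring
    have hrot := HasShape.iterate_rotate (t := (d, e, D)) hshape k
    obtain ⟨x₀, x₁, y₀, y₁, z₀, z₁, h1, h2, h3, h4, h5⟩ := hrot
    have hmove : P.image (TriLattice.move k (-x₀, 1 - y₁)) =
        box 0 (x₁ - x₀) (y₀ + 1 - y₁) 1 (z₀ - x₀ + 1 - y₁) (z₁ - x₀ + 1 - y₁) := by
      rw [image_move, h5, box_translate]
      congr 1 <;> simp only <;> ring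
    have hEB : IsEB r (i + 1) (P.image (TriLattice.move k (-x₀, 1 - y₁))) := by
      rw [hmove]
      exact isEB_succ_of_canRemove hr (by omega) (fun Q hQ => ih (by omega) hQ) hk (hdef' k)
        (by omega) (by omega) (by omega) (by omega)
    obtain ⟨k', t', hinv⟩ := exists_move_comp_eq_id k (-x₀, 1 - y₁)
    have := hEB.move k' t'
    rwa [Finset.image_image, hinv, Finset.image_id] at this

theorem isEB_iff_isExtremal {r i : ℕ} (hr : 1 ≤ r) (hi : i ≤ 6) {P : Finset Face} :
    IsEB r i P ↔ IsExtremal r i P :=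
  ⟨fun h => h.isExtremal hr hi, fun h => h.isEB hr hi⟩

/-! ### The isoperimetric inequality and the classification of maximizers. -/

theorem minDeficit_le_deficit {S d e D : ℤ} {P : Finset Face} (h : HasShape S d e D P)
    {q : ℤ} {i : ℕ} (hi : i ≤ 5) (hS : S = 6 * q + i) : minDeficit i ≤ deficit d e D := by
  by_cases hd : deficit d e D ≤ 7
  · obtain ⟨h1, h2, h3, h4⟩ := abs_le_one_of_deficit_le hd
    obtain ⟨x₀, x₁, y₀, y₁, z₀, z₁, k1, k2, k3, k4, rfl⟩ := h
    have hmod : (i - d + e) % 3 = 0 := by omega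
    have hpar : (i - D) % 2 = 0 := by omega
    have key : ∀ i ∈ List.range 6, ∀ d ∈ ([-1, 0, 1] : List ℤ), ∀ e ∈ ([-1, 0, 1] : List ℤ),
        ∀ D ∈ ([-1, 0, 1] : List ℤ), (i - d + e) % 3 = 0 → (i - D) % 2 = 0 →
        minDeficit i ≤ deficit d e D := by
      decide +kernel
    refine key i (List.mem_range.2 (by omega)) d ?_ e ?_ D ?_ hmod hpar <;>
      simp only [List.mem_cons, List.not_mem_nil, or_false] <;> omega
  · have := minDeficit_le i
    omega

/-- The isoperimetric inequality for the site-perimeter, with the regions attaining equality. -/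
theorem IsPolyiamond.area_le {P : Finset Face} (hP : IsPolyiamond P) {r i : ℕ} (hr : 1 ≤ r)
    (hi : i ≤ 5) (hs : sitePerimeter P ≤ 6 * r + i) :
    6 * (P.card : ℤ) + minDeficit i ≤ (6 * r + i) ^ 2 ∧
      (6 * (P.card : ℤ) + minDeficit i = (6 * r + i) ^ 2 →
        sitePerimeter P = 6 * r + i ∧ IsExtremal r i P) := by
  obtain ⟨x₀, x₁, y₀, y₁, z₀, z₁, hsub, htight, ⟨hx, hy, hz⟩, hle⟩ := hP.exists_box
  have hcard : (P.card : ℤ) ≤ (box x₀ x₁ y₀ y₁ z₀ z₁).card := by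
    exact_mod_cast Finset.card_le_card hsub
  have hsq := sq_eq_card_add_deficit htight
  obtain ⟨S, hS⟩ : ∃ S, S = (x₁ - x₀) + (y₁ - y₀) + (z₁ - z₀) := ⟨_, rfl⟩
  obtain ⟨δ, hδ⟩ : ∃ δ, δ = deficit ((x₁ - x₀) - (y₁ - y₀)) ((y₁ - y₀) - (z₁ - z₀))
        (z₀ + z₁ - x₀ - x₁ - y₀ - y₁) := ⟨_, rfl⟩
  rw [← hS, ← hδ] at hsq
  have hshape : HasShape S _ _ _ (box x₀ x₁ y₀ y₁ z₀ z₁) :=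
    ⟨x₀, x₁, y₀, y₁, z₀, z₁, hS.symm, rfl, rfl, rfl, rfl⟩
  have hS3 : 3 ≤ S := by omega
  obtain ⟨q, j, hj, hSq⟩ : ∃ (q : ℤ) (j : ℕ), j ≤ 5 ∧ S = 6 * q + j :=
    ⟨S / 6, (S % 6).toNat, by omega, by omega⟩
  have hmin := minDeficit_le_deficit hshape hj hSq
  rw [← hδ] at hmin
  rcases lt_or_ge S (6 * r + i) with hlt | hge
  · have hlt' : S ^ 2 - minDeficit j + minDeficit i < (6 * r + i) ^ 2 := by
      have h7 := minDeficit_le i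
      have hj0 : 0 ≤ minDeficit j := by unfold minDeficit; split <;> norm_num
      rcases lt_or_ge (S + 1) (6 * r + i) with h2 | h1
      · nlinarith
      · have heq : (6 * r + i : ℤ) = S + 1 := by omega
        -- One unit of perimeter gains `2 * S + 1`, at least 7 since `3 ≤ S`, which must exceed
        -- `minDeficit i - minDeficit j ≤ 7`. The difference 7 requires `j = 0`, and then `S` is a
        -- positive multiple of 6.
        have hstep : minDeficit i ≤ minDeficit j + 6 ∨ 6 ≤ S := by
          by_cases hj0' : j = 0
          · right; omega
          · left
            have : ∀ j ∈ List.range 6, j ≠ 0 → 3 ≤ minDeficit j := by decide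
            have := this j (List.mem_range.2 (by omega)) hj0'
            omega
        rw [heq]
        rcases hstep with h | h <;> nlinarith
    constructor
    · linarith
    · intro h
      linarith
  · have hSe : S = 6 * r + i := by omega
    have hji : j = i := by omega
    subst hji
    rw [hSe] at hsq hshape
    constructor
    · linarith
    · intro h
      have hPc : P.card = (box x₀ x₁ y₀ y₁ z₀ z₁).card := by
        have : (P.card : ℤ) = (box x₀ x₁ y₀ y₁ z₀ z₁).card := by linarith
        exact_mod_cast this
      have hPe := Finset.eq_of_subset_of_card_le hsub hPc.ge
      refine ⟨by omega, ?_⟩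
      rw [hPe]
      exact ⟨_, _, _, hshape, by rw [← hδ]; linarith⟩

theorem IsExtremal.area_eq {r i : ℕ} (hr : 1 ≤ r) {P : Finset Face} (h : IsExtremal r i P) :
    IsPolyiamond P ∧ sitePerimeter P ≤ 6 * r + i ∧
      6 * (P.card : ℤ) + minDeficit i = (6 * r + i) ^ 2 := by
  obtain ⟨d, e, D, hshape, hdef⟩ := h
  have hdle := hdef.trans_le (minDeficit_le i)
  have h1 := hshape.card (by omega) hdle
  have h2 := hshape.sitePerimeter_le (by omega) hdle
  refine ⟨hshape.isPolyiamond (by omega) hdle, by omega, by rw [h1, hdef]⟩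

theorem exists_isEB (r i : ℕ) (hr : 1 ≤ r) (hi : i ≤ 6) : ∃ E, IsEB r i E := by
  have key : ∀ i ∈ List.range 7, ∃ d ∈ ([-1, 0, 1] : List ℤ), ∃ e ∈ ([-1, 0, 1] : List ℤ),
      ∃ D ∈ ([-1, 0, 1] : List ℤ), deficit d e D = minDeficit i ∧ (i - d + e) % 3 = 0 ∧
        (i - D) % 2 = 0 := by
    decide +kernel
  obtain ⟨d, -, e, -, D, -, h1, h2, h3⟩ := key i (List.mem_range.2 (by omega))
  -- The congruences modulo 3 and 2 are what makes the `y` width `w` and the lower bound `a` of the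
  -- third coordinate integers.
  obtain ⟨w, hw⟩ : ∃ w : ℤ, 3 * w = 6 * r + i - d + e := ⟨(6 * r + i - d + e) / 3, by omega⟩
  obtain ⟨a, ha⟩ : ∃ a : ℤ, 2 * a = D + (w + d) + w - (w - e) :=
    ⟨(D + (w + d) + w - (w - e)) / 2, by omega⟩
  refine ⟨_, IsExtremal.isEB hr hi ⟨d, e, D, ⟨0, w + d, 0, w, a, a + (w - e), ?_, ?_, ?_, ?_, rfl⟩,
    h1⟩⟩ <;> omega

theorem isAreaMaximizer_iff_isEB {r i : ℕ} (hr : 1 ≤ r) (hi : i ≤ 5) (P : Finset Face) :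
    IsAreaMaximizer (6 * r + i) P ↔ IsEB r i P := by
  rw [isEB_iff_isExtremal hr (by omega)]
  constructor
  · rintro ⟨hP, hs, hmax⟩
    obtain ⟨E, hE⟩ := exists_isEB r i hr (by omega)
    obtain ⟨h1, h2, h3⟩ := (hE.isExtremal hr (by omega)).area_eq hr
    -- `E` attains the area bound, so its site-perimeter is exactly `6 * r + i` and it may be
    -- compared with `P`.
    have h4 := (h1.area_le hr hi h2).2 h3
    have h5 : (E.card : ℤ) ≤ P.card := by exact_mod_cast hmax E h1 h4.1
    have h6 := hP.area_le hr hi hs.le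
    exact (h6.2 (by linarith [h6.1])).2
  · intro h
    obtain ⟨h1, h2, h3⟩ := h.area_eq hr
    refine ⟨h1, ((h1.area_le hr hi h2).2 h3).1, fun Q hQ hQs => ?_⟩
    have h4 := (hQ.area_le hr hi hQs.le).1
    omega

theorem IsExtremal.latticeCongruent {r i : ℕ} (hi : i ≤ 5) {P Q : Finset Face}
    (hP : IsExtremal r i P) (hQ : IsExtremal r i Q) : LatticeCongruent P Q := by
  obtain ⟨d, e, D, hP, hPd⟩ := hP
  obtain ⟨d', e', D', hQ, hQd⟩ := hQ
  have hPm := hP.emod_three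
  have hQm := hQ.emod_three
  obtain ⟨h1, h2, h3⟩ := mem_params_of_deficit_eq hPd
  obtain ⟨h1', h2', h3'⟩ := mem_params_of_deficit_eq hQd
  obtain ⟨k, -, hk⟩ := exists_rotateParams_eq i (List.mem_range.2 (by omega)) d h1 e h2 D h3 hPd
    (by omega) d' h1' e' h2' D' h3' hQd (by omega)
  have hrot := HasShape.iterate_rotate (t := (d, e, D)) hP k
  rw [hk] at hrot
  obtain ⟨t, ht⟩ := hrot.exists_translate hQ
  exact ⟨k, t, by rw [ht, image_move]⟩

/-- `minDeficit 6` is 0 by the default case, so six bars complete the hexagon of radius `r + 1`. -/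
theorem IsEB.of_six {r : ℕ} (hr : 1 ≤ r) {P : Finset Face} (h : IsEB r 6 P) :
    IsEB (r + 1) 0 P := by
  obtain ⟨d, e, D, hshape, hdef⟩ := h.isExtremal hr le_rfl
  refine IsExtremal.isEB (by omega) (by omega) ⟨d, e, D, ?_, hdef⟩
  have : (6 * ((r + 1 : ℕ) : ℤ) + (0 : ℕ)) = 6 * r + (6 : ℕ) := by push_cast; ring
  rwa [this]

end TriLattice

theorem mainTheorem8 :
    (∀ s : ℕ, 6 ≤ s → ∀ P : Finset Face,
      IsAreaMaximizer s P ↔ IsQuasiRegularHexagon P ∧ sitePerimeter P = s) ∧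
    (∀ r i : ℕ, 1 ≤ r → i ≤ 5 →
      (∀ P : Finset Face, IsAreaMaximizer (6 * r + i) P ↔ IsEB r i P) ∧
      ∃ E : Finset Face, IsEB r i E ∧ ∀ P : Finset Face, IsEB r i P ↔ LatticeCongruent E P) := by
  refine ⟨fun s hs P => ?_, fun r i hr hi => ⟨isAreaMaximizer_iff_isEB hr hi, ?_⟩⟩
  · constructor
    · intro h
      obtain ⟨r, i, hr, hi, rfl⟩ : ∃ r i, 1 ≤ r ∧ i ≤ 5 ∧ s = 6 * r + i :=
        ⟨s / 6, s % 6, by omega, by omega, by omega⟩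
      exact ⟨⟨r, i, hr, by omega, (isAreaMaximizer_iff_isEB hr hi P).1 h⟩, h.2.1⟩
    · rintro ⟨⟨r, i, hr, hi, h⟩, rfl⟩
      have key : ∀ r i : ℕ, 1 ≤ r → i ≤ 5 → IsEB r i P →
          IsAreaMaximizer (sitePerimeter P) P := by
        intro r i hr hi h
        have hmax := (isAreaMaximizer_iff_isEB hr hi P).2 h
        rwa [hmax.2.1]
      rcases Nat.lt_or_ge i 6 with h6 | h6
      · exact key r i hr (by omega) h
      · obtain rfl : i = 6 := by omega
        exact key (r + 1) 0 (by omega) (by omega) (h.of_six hr)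
  · obtain ⟨E, hE⟩ := exists_isEB r i hr (by omega)
    refine ⟨E, hE, fun P => ⟨fun hP => ?_, ?_⟩⟩
    · exact (hE.isExtremal hr (by omega)).latticeCongruent hi (hP.isExtremal hr (by omega))
    · rintro ⟨k, t, rfl⟩
      exact hE.move k t
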